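/- Let $\tilde Q$ be a $\tilde Q$-expansion of $[0,1]$: for every $k\ge 1$ a number $N_k\in\mathbb N$ and a probability vector $(q_{ik})_{0\le i<N_k}$ with positive entries are given, and $\prod_{k}\max_i q_{ik}=0$. Starting from $[0,1]$ (the cylinder of rank $0$), each cylinder $\Delta_{a_1\dots a_{n-1}}$ of rank $n-1$ is divided, from left to right, into closed intervals $\Delta_{a_1\dots a_{n-1}i}$, $0\le i<N_n$ (the cylinders of rank $n$), of lengths $q_{in}|\Delta_{a_1\dots a_{n-1}}|$; $\Delta_{a_1a_2\dots}$ is the unique point of $\bigcap_n\Delta_{a_1\dots a_n}$. Let $\varPhi$ be the family of interiors of all cylinders. Assume that $\inf_{i,k} q_{ik}>0$. Let $\xi=\Delta_{\xi_1\xi_2\dots}$ be a random variable with independent $\tilde Q$-digits $\xi_k$ ($\xi_k$ takes values in $\{0,\dots,N_k-1\}$, with an arbitrary distribution), and let $F$ be its distribution function. Assume that $$\lim_{n\to\infty}\frac{\ln\lambda(F(\Delta_n(x)))}{\ln\lambda(\Delta_n(x))}=1\qquad\text{for all }x\in[0,1],$$ where $\lambda$ is Lebesgue measure and $\Delta_n(x)$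 is the cylinder of rank $n$ that contains $x$ (for the countably many $x$ that have two expansions it is enough that this holds for one of them). Then the family $\varPhi'=F(\varPhi)=\{F(A):A\in\varPhi\}$ is faithful for packing dimension calculation on $[0,1]$, that is, $\dim_P(E,\varPhi')=\dim_{P(\mathrm{unc})}(E)$ for all $E\subset[0,1]$; moreover $\dim_P(E,\varPhi')=\dim_P(E)$ for all $E\subset[0,1]$. Here, for a family $\varPsi$ of sets, an $\varepsilon$-packing of $E$ in $\varPsi$ is an at most countable family of pairwise disjoint members of $\varPsi$ of diameter at most $\varepsilon$, each of which meets $E$. Put $\mathcal P^\alpha_\varepsilon(E,\varPsi)=\sup\sum_j|E_j|^\alpha$ over all such packings $\{E_j\}$ ($|\cdot|$ is the diameter), $\mathcal P^\alpha_0(E,\varPsi)=\lim_{\varepsilon\to0}\mathcal P^\alpha_\varepsilon(E,\varPsi)$, $\mathcal P^\alpha(E,\varPsi)=\inf\{\sum_j\mathcal P^\alpha_0(E_j,\varPsi):E\subset\bigcup_jE_j\}$ over countable coverings, and $\dim_P(E,\varPsi)=\inf\{\alpha\ge0:\mathcal P^\alpha(E,\varPsi)=0\}$. The uncentered packing dimension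 $\dim_{P(\mathrm{unc})}(E)$ is $\dim_P(E,\varPsi)$ for $\varPsi$ the family of all open balls, and the packing dimension $\dim_P(E)$ is defined in the same way with packings of $E$ by open balls whose centers lie in $E$. -/

import Mathlib

open Filter Topology MeasureTheory ProbabilityTheory
open scoped ENNReal NNReal

noncomputable section

namespace PackingDim

/-! ### Packing dimensions

A packing is a countable set `S` of pairwise disjoint sets. The three kinds of packing dimension
below (centered, uncentered, uncentered with respect to a family) differ only in which packings of
a set `E` are admitted, so the construction is given once, for a predicate `pk` with `pk E ε S`
meaning that `S` is an admissible `ε`-packing of `E`. -/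

/-- `S` is an uncentered `ε`-packing of `E` by members of the family `Φ`: a countable family of
pairwise disjoint members of `Φ`, of diameter at most `ε`, each of which meets `E`. -/
structure IsPackingIn {M : Type*} [MetricSpace M] (Φ : Set (Set M))
    (E : Set M) (ε : ℝ≥0∞) (S : Set (Set M)) : Prop where
  countable : S.Countable
  subset : S ⊆ Φ
  ediam_le : ∀ A ∈ S, Metric.ediam A ≤ ε
  inter_nonempty : ∀ A ∈ S, (A ∩ E).Nonempty
  disjoint : S.PairwiseDisjoint id

/-- `S` is a (centered) `ε`-packing of `E`: a countable family of pairwise disjoint open balls of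
diameter at most `ε`, with centers in `E`. -/
structure IsCenteredPacking {M : Type*} [MetricSpace M]
    (E : Set M) (ε : ℝ≥0∞) (S : Set (Set M)) : Prop where
  countable : S.Countable
  ball : ∀ A ∈ S, ∃ c ∈ E, ∃ r : ℝ, 0 < r ∧ A = Metric.ball c r
  ediam_le : ∀ A ∈ S, Metric.ediam A ≤ ε
  disjoint : S.PairwiseDisjoint id

/-- The `α`-dimensional packing premeasure `𝒫^α_ε(E)`: the supremum of `∑ |A|^α` over the
admissible `ε`-packings of `E`. -/
def premeasure {M : Type*} [MetricSpace M] (pk : Set M → ℝ≥0∞ → Set (Set M) → Prop)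
    (α : ℝ≥0) (ε : ℝ≥0∞) (E : Set M) : ℝ≥0∞ :=
  ⨆ (S : Set (Set M)) (_ : pk E ε S), ∑' A : S, Metric.ediam (A : Set M) ^ (α : ℝ)

/-- The `α`-dimensional packing quasi-measure `𝒫^α_0(E)`, the limit of the premeasures as `ε → 0`
(they are monotone in `ε`, so the limit is an infimum). -/
def quasiMeasure {M : Type*} [MetricSpace M] (pk : Set M → ℝ≥0∞ → Set (Set M) → Prop)
    (α : ℝ≥0) (E : Set M) : ℝ≥0∞ :=
  ⨅ (ε : ℝ≥0∞) (_ : 0 < ε), premeasure pk α ε E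

/-- The `α`-dimensional packing measure `𝒫^α(E)`: the infimum of `∑ 𝒫^α_0(E_j)` over the countable
coverings `(E_j)` of `E`. Finite coverings are padded by empty sets, whose quasi-measure is `0`. -/
def packingMeasure {M : Type*} [MetricSpace M] (pk : Set M → ℝ≥0∞ → Set (Set M) → Prop)
    (α : ℝ≥0) (E : Set M) : ℝ≥0∞ :=
  ⨅ (t : ℕ → Set M) (_ : E ⊆ ⋃ j, t j), ∑' j, quasiMeasure pk α (t j)

/-- The dimension `inf {α ≥ 0 : 𝒫^α(E) = 0}`. -/
def dimOf {M : Type*} [MetricSpace M] (pk : Set M → ℝ≥0∞ → Set (Set M) → Prop)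
    (E : Set M) : ℝ≥0∞ :=
  ⨅ (α : ℝ≥0) (_ : packingMeasure pk α E = 0), (α : ℝ≥0∞)

/-- The packing dimension `dim_P(E)`. -/
def dimP {M : Type*} [MetricSpace M] (E : Set M) : ℝ≥0∞ :=
  dimOf IsCenteredPacking E

/-- The packing dimension `dim_P(E, Φ)` with respect to the family `Φ`. -/
def dimPIn {M : Type*} [MetricSpace M] (Φ : Set (Set M)) (E : Set M) : ℝ≥0∞ :=
  dimOf (IsPackingIn Φ) E

/-- The family of all open balls. -/
def openBalls (M : Type*) [MetricSpace M] : Set (Set M) :=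
  {A | ∃ (c : M) (r : ℝ), 0 < r ∧ A = Metric.ball c r}

/-- The uncentered packing dimension `dim_{P(unc)}(E)`. -/
def dimPUnc {M : Type*} [MetricSpace M] (E : Set M) : ℝ≥0∞ :=
  dimPIn (openBalls M) E

/-- The family `Φ` is faithful for (uncentered) packing dimension calculation on `X`. -/
def IsFaithfulOn {M : Type*} [MetricSpace M] (Φ : Set (Set M)) (X : Set M) : Prop :=
  ∀ E ⊆ X, dimPIn Φ E = dimPUnc E

end PackingDim

/-- The data of a `Q̃`-expansion of `[0, 1]` with finite columns: the `k`-th digit (`k = 0, 1, …`)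
ranges over `{0, …, N k - 1}`, the `k`-th column `q k` of the matrix is a probability vector with
positive entries, and `∏ₖ maxᵢ q k i = 0`. -/
structure QTilde where
  /-- the number of values of the `k`-th digit -/
  N : ℕ → ℕ
  /-- the matrix -/
  q : (k : ℕ) → Fin (N k) → ℝ
  q_pos : ∀ k i, 0 < q k i
  sum_q : ∀ k, ∑ i, q k i = 1
  prod_max : Tendsto (fun n => ∏ k ∈ Finset.range n, ⨆ i, q k i) atTop (𝓝 0)

namespace QTilde

/-- Sequences of digits. -/
abbrev Digits (Q : QTilde) : Type := (k : ℕ) → Fin (Q.N k)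

/-- The length `q_{a₀ 0} ⋯ q_{aₙ₋₁ n-1}` of the cylinder of rank `n` given by the first `n` digits
of `a`. -/
def len (Q : QTilde) (a : Q.Digits) (n : ℕ) : ℝ :=
  ∏ k ∈ Finset.range n, Q.q k (a k)

/-- The `k`-th term `(∑_{i < aₖ} q_{i k}) · q_{a₀ 0} ⋯ q_{aₖ₋₁ k-1}` of the expansion. -/
def term (Q : QTilde) (a : Q.Digits) (k : ℕ) : ℝ :=
  (∑ i ∈ Finset.Iio (a k), Q.q k i) * Q.len a k

/-- The left end of the cylinder of rank `n` given by the first `n` digits of `a`. -/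
def left (Q : QTilde) (a : Q.Digits) (n : ℕ) : ℝ :=
  ∑ k ∈ Finset.range n, Q.term a k

/-- The cylinder `Δ_{a₀ … aₙ₋₁}` of rank `n`, a closed interval; each cylinder of rank `n` is
divided, from left to right, into cylinders of rank `n + 1` in the proportions `q n i`. -/
def cyl (Q : QTilde) (a : Q.Digits) (n : ℕ) : Set ℝ :=
  Set.Icc (Q.left a n) (Q.left a n + Q.len a n)

/-- The number `Δ_{a₀ a₁ a₂ …}` with digits `a`. -/
def value (Q : QTilde) (a : Q.Digits) : ℝ :=
  ∑' k, Q.term a k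

/-- The family of cylindric intervals, that is, of interiors of cylinders. -/
def cylIntervals (Q : QTilde) : Set (Set ℝ) :=
  {A | ∃ (a : Q.Digits) (n : ℕ), A = interior (Q.cyl a n)}

end QTilde

end

/-! A packing by balls of the line can be traded, one dyadic scale at a time, for a packing by other
sets. Balls of diameter in `(h, 2h]` split into four classes in which chosen points of `E` are more
than `h` apart. If every such point lies in an admissible set of diameter between `C * h ^ γ` and `h
/ 2`, these sets are disjoint, so a finite `α`-premeasure bounds the number of balls by a multiple
of `h ^ (-γ * α)`. For `β > γ * α` the `β`-sums over scales form a convergent geometric series with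
vanishing tails. Letting `γ → 1` gives `dimPUnc_le_dimOf`, where `E` need only be covered by
countably many pieces on which such sets exist. Centered balls are one instance, whence
`dimPUnc_eq_dimP`.

For images of cylinders, `F` must be a homeomorphism of `[0, 1]`. An atom would make the
distribution discrete (Borel–Cantelli) and the range of `F` null, against the limit hypothesis; the
same hypothesis excludes intervals of constancy. Away from the countably many ends, the limit says
that from some rank `m` on the lengths of a cylinder and of its image are comparable up to an
exponent `s` near `1`. As `q` is bounded below, consecutive image lengths cannot drop too far, so
every small scale is met (`hasPackingSets_image`). Sorting points by `m` gives the countable cover.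
-/

noncomputable section

/-! ### Packings and the comparison at one scale -/

namespace PackingDim

variable {M : Type*} [MetricSpace M]

lemma premeasure_mono_pk {pk pk' : Set M → ℝ≥0∞ → Set (Set M) → Prop} {E E' : Set M} {ε ε' : ℝ≥0∞}
    (h : ∀ S, pk E ε S → pk' E' ε' S) (α : ℝ≥0) :
    premeasure pk α ε E ≤ premeasure pk' α ε' E' :=
  iSup₂_le fun S hS => le_iSup₂_of_le S (h S hS) le_rfl

lemma quasiMeasure_mono_pk {pk pk' : Set M → ℝ≥0∞ → Set (Set M) → Prop} {E E' : Set M}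
    (h : ∀ ε S, pk E ε S → pk' E' ε S) (α : ℝ≥0) :
    quasiMeasure pk α E ≤ quasiMeasure pk' α E' :=
  iInf₂_mono fun ε _ => premeasure_mono_pk (h ε) α

lemma dimOf_mono {pk pk' : Set M → ℝ≥0∞ → Set (Set M) → Prop}
    (h : ∀ E ε S, pk E ε S → pk' E ε S) (E : Set M) : dimOf pk E ≤ dimOf pk' E := by
  refine le_iInf₂ fun α hα => iInf₂_le_of_le α ?_ le_rfl
  refine le_antisymm ?_ zero_le
  rw [← hα]
  exact iInf₂_mono fun t _ => ENNReal.tsum_le_tsum fun j => quasiMeasure_mono_pk (h (t j)) α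

lemma IsPackingIn.mono {Φ Φ' : Set (Set M)} (hΦ : Φ ⊆ Φ') {E E' : Set M} (hE : E ⊆ E') {ε : ℝ≥0∞}
    {S : Set (Set M)} (h : IsPackingIn Φ E ε S) : IsPackingIn Φ' E' ε S :=
  ⟨h.countable, h.subset.trans hΦ, h.ediam_le,
    fun A hA => (h.inter_nonempty A hA).mono (Set.inter_subset_inter_right _ hE), h.disjoint⟩

lemma IsCenteredPacking.isPackingIn {E : Set M} {ε : ℝ≥0∞}
    {S : Set (Set M)} (h : IsCenteredPacking E ε S) : IsPackingIn (openBalls M) E ε S where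
  countable := h.countable
  subset A hA := let ⟨c, _, r, hr, hA'⟩ := h.ball A hA; ⟨c, r, hr, hA'⟩
  ediam_le := h.ediam_le
  inter_nonempty A hA := by
    obtain ⟨c, hc, r, hr, rfl⟩ := h.ball A hA
    exact ⟨c, Metric.mem_ball_self hr, hc⟩
  disjoint := h.disjoint

lemma dimP_le_dimPUnc (E : Set M) : dimP E ≤ dimPUnc E :=
  dimOf_mono (fun _ _ _ h => h.isPackingIn) E

lemma dimPIn_mono {Φ Φ' : Set (Set M)} (hΦ : Φ ⊆ Φ') (E : Set M) : dimPIn Φ E ≤ dimPIn Φ' E :=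
  dimOf_mono (fun _ _ _ h => h.mono hΦ subset_rfl) E

/-- Disjoint sets through a common point reduce to a single set, so a packing sum is at most `ε ^
β`. This disposes of the countably many exceptional points. -/
lemma quasiMeasure_of_subsingleton (Φ : Set (Set M)) {E : Set M} (hE : E.Subsingleton) {β : ℝ≥0}
    (hβ : 0 < β) : quasiMeasure (IsPackingIn Φ) β E = 0 := by
  have h : ∀ ε : ℝ≥0∞, premeasure (IsPackingIn Φ) β ε E ≤ ε ^ (β : ℝ) := by
    refine fun ε => iSup₂_le fun S hS => ?_
    have hS1 : S.Subsingleton := by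
      intro A hA B hB
      obtain ⟨x, hxA, hx⟩ := hS.inter_nonempty A hA
      obtain ⟨y, hyB, hy⟩ := hS.inter_nonempty B hB
      obtain rfl := hE hx hy
      by_contra hAB
      exact Set.disjoint_left.1 (hS.disjoint hA hB hAB) hxA hyB
    rcases hS1.eq_empty_or_singleton with rfl | ⟨A, rfl⟩
    · simp
    · rw [tsum_singleton A fun B : Set M => Metric.ediam B ^ (β : ℝ)]
      exact ENNReal.rpow_le_rpow (hS.ediam_le A rfl) β.2
  refine le_antisymm (ENNReal.le_of_forall_pos_le_add fun δ hδ _ => ?_) zero_le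
  have hβ' : (β : ℝ) ≠ 0 := by exact_mod_cast hβ.ne'
  refine iInf₂_le_of_le ((δ : ℝ≥0∞) ^ (β : ℝ)⁻¹)
    (ENNReal.rpow_pos (by exact_mod_cast hδ) ENNReal.coe_ne_top) ((h _).trans ?_)
  rw [← ENNReal.rpow_mul, inv_mul_cancel₀ hβ', ENNReal.rpow_one, zero_add]

/-- Around every point of `T` and at every small scale `ρ` there is a set admissible for packings
in the sense of `pk`, of diameter between `c * ρ ^ γ` and `ρ`. -/
def HasPackingSets (pk : Set M → ℝ≥0∞ → Set (Set M) → Prop) (T : Set M) (γ : ℝ) : Prop :=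
  ∃ c : ℝ, 0 < c ∧ ∃ ρ₀ : ℝ, 0 < ρ₀ ∧ ∀ x ∈ T, ∀ ρ : ℝ, 0 < ρ → ρ < ρ₀ → ∃ A : Set M, x ∈ A ∧
    Metric.ediam A ≤ ENNReal.ofReal ρ ∧ ENNReal.ofReal (c * ρ ^ γ) ≤ Metric.ediam A ∧
    pk {x} (ENNReal.ofReal ρ) {A}

/-- A packing is a countable disjoint family of sets that are admissible one by one, and
admissibility is monotone in the set that is packed and in the bound for the diameters. -/
structure IsPackingPredicate (pk : Set M → ℝ≥0∞ → Set (Set M) → Prop) : Prop where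
  mono : ∀ {E E' : Set M} {ε ε' : ℝ≥0∞} {S : Set (Set M)}, E ⊆ E' → ε ≤ ε' → pk E ε S → pk E' ε' S
  of_singletons : ∀ {E : Set M} {ε : ℝ≥0∞} {S : Set (Set M)}, S.Countable → S.PairwiseDisjoint id →
    (∀ A ∈ S, pk E ε {A}) → pk E ε S

lemma isPackingPredicate_isPackingIn (Φ : Set (Set M)) : IsPackingPredicate (IsPackingIn Φ) where
  mono hE hε h := ⟨h.countable, h.subset, fun A hA => (h.ediam_le A hA).trans hε,
    fun A hA => (h.inter_nonempty A hA).mono (Set.inter_subset_inter_right _ hE), h.disjoint⟩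
  of_singletons hc hd h := ⟨hc, fun A hA => (h A hA).subset rfl, fun A hA => (h A hA).ediam_le A rfl,
    fun A hA => (h A hA).inter_nonempty A rfl, hd⟩

lemma isPackingPredicate_isCenteredPacking :
    IsPackingPredicate (IsCenteredPacking (M := M)) where
  mono hE hε h := ⟨h.countable, fun A hA => let ⟨c, hc, r⟩ := h.ball A hA; ⟨c, hE hc, r⟩,
    fun A hA => (h.ediam_le A hA).trans hε, h.disjoint⟩
  of_singletons hc hd h := ⟨hc, fun A hA => (h A hA).ball A rfl, fun A hA => (h A hA).ediam_le A rfl,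
    hd⟩

/-- Separated points of `T` carry a packing of `T`, one set for each point. -/
lemma tsum_const_le_premeasure {pk : Set M → ℝ≥0∞ → Set (Set M) → Prop}
    (hpk : IsPackingPredicate pk) {T : Set M} {ι : Type*} [Countable ι] {x : ι → M}
    (hxT : ∀ i, x i ∈ T) {ρ d : ℝ} (hρ : 0 < ρ)
    (hsep : ∀ i j, i ≠ j → 2 * ρ < dist (x i) (x j))
    (hA : ∀ i, ∃ A : Set M, x i ∈ A ∧ Metric.ediam A ≤ ENNReal.ofReal ρ ∧
      ENNReal.ofReal d ≤ Metric.ediam A ∧ pk {x i} (ENNReal.ofReal ρ) {A})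
    (α : ℝ≥0) {ε : ℝ≥0∞} (hε : ENNReal.ofReal ρ ≤ ε) :
    ∑' _ : ι, ENNReal.ofReal d ^ (α : ℝ) ≤ premeasure pk α ε T := by
  choose A hxA hdA hdA' hpA using hA
  have hdisj : ∀ i j, i ≠ j → Disjoint (A i) (A j) := by
    intro i j hij
    rw [Set.disjoint_left]
    intro z hzi hzj
    have h1 : edist (x i) z ≤ ENNReal.ofReal ρ :=
      (Metric.edist_le_ediam_of_mem (hxA i) hzi).trans (hdA i)
    have h2 : edist z (x j) ≤ ENNReal.ofReal ρ :=
      (Metric.edist_le_ediam_of_mem hzj (hxA j)).trans (hdA j)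
    rw [edist_dist, ENNReal.ofReal_le_ofReal_iff hρ.le] at h1 h2
    linarith [dist_triangle (x i) z (x j), hsep i j hij]
  have hinj : Function.Injective A := by
    intro i j hij
    by_contra hne
    exact Set.disjoint_left.1 (hdisj i j hne) (hxA i) (hij ▸ hxA i)
  refine le_iSup₂_of_le (Set.range A) (hpk.of_singletons (Set.countable_range A) ?_ ?_) ?_
  · rintro _ ⟨i, rfl⟩ _ ⟨j, rfl⟩ hij
    exact hdisj i j fun h => hij (h ▸ rfl)
  · rintro _ ⟨i, rfl⟩
    exact hpk.mono (Set.singleton_subset_iff.2 (hxT i)) hε (hpA i)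
  · rw [tsum_range (fun B : Set M => Metric.ediam B ^ (α : ℝ)) hinj]
    exact ENNReal.tsum_le_tsum fun i => ENNReal.rpow_le_rpow (hdA' i) α.2

lemma ediam_ball_real (c : ℝ) (r : ℝ) :
    Metric.ediam (Metric.ball c r) = ENNReal.ofReal (2 * r) := by
  rw [Real.ball_eq_Ioo, Real.ediam_Ioo]; congr 1; ring

/-- Disjoint open balls of the line with diameters in `(h, 2h]` that meet `T` fall into four classes
in each of which points of `T` chosen in the balls are more than `h` apart. -/
lemma tsum_const_le_of_comparable_balls {pk : Set ℝ → ℝ≥0∞ → Set (Set ℝ) → Prop}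
    (hpk : IsPackingPredicate pk) {T : Set ℝ} {ι : Type*} [Countable ι] {m r : ι → ℝ} {h : ℝ}
    (hh : 0 < h) (hr : ∀ i, h < 2 * r i) (hr' : ∀ i, r i ≤ h)
    (hdisj : ∀ i j, i ≠ j → Disjoint (Metric.ball (m i) (r i)) (Metric.ball (m j) (r j)))
    (hne : ∀ i, (Metric.ball (m i) (r i) ∩ T).Nonempty) {d : ℝ}
    (hA : ∀ x ∈ T, ∃ A : Set ℝ, x ∈ A ∧ Metric.ediam A ≤ ENNReal.ofReal (h / 2) ∧
      ENNReal.ofReal d ≤ Metric.ediam A ∧ pk {x} (ENNReal.ofReal (h / 2)) {A})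
    (α : ℝ≥0) {ε : ℝ≥0∞} (hε : ENNReal.ofReal (h / 2) ≤ ε) :
    ∑' _ : ι, ENNReal.ofReal d ^ (α : ℝ) ≤ 4 * premeasure pk α ε T := by
  choose x hxm hxT using hne
  -- Otherwise the midpoint of the centers lies in both balls, whose radii exceed `h / 2`.
  have hsep : ∀ i j, i ≠ j → h < |m i - m j| := by
    intro i j hij
    by_contra! hle
    have h1 := hr i
    have h2 := hr j
    refine (hdisj i j hij).notMem_of_mem_left (a := (m i + m j) / 2) ?_ ?_ <;>
    · rw [Metric.mem_ball, Real.dist_eq, abs_lt]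
      rw [abs_le] at hle
      constructor <;> linarith
  -- Equal floors are excluded by `hsep`. Distinct floors in one class differ by at least `4`, so
  -- the centers are more than `3 * h` apart; each chosen point is within `h` of its center, which
  -- leaves more than `h`.
  let g : ι → ZMod 4 := fun i => (⌊m i / h⌋ : ℤ)
  have hclass : ∀ c : ZMod 4, ∑' _ : g ⁻¹' {c}, ENNReal.ofReal d ^ (α : ℝ) ≤
      premeasure pk α ε T := by
    intro c
    refine tsum_const_le_premeasure hpk (x := fun i : g ⁻¹' {c} => x i) (fun i => hxT i)
      (half_pos hh) ?_ (fun i => hA _ (hxT i)) α hε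
    rintro ⟨i, hi⟩ ⟨j, hj⟩ hij
    have hij' : i ≠ j := fun h => hij (Subtype.ext h)
    have hg : ((⌊m i / h⌋ : ℤ) : ZMod 4) = (⌊m j / h⌋ : ℤ) :=
      (show g i = c from hi).trans (show g j = c from hj).symm
    rw [ZMod.intCast_eq_intCast_iff_dvd_sub] at hg
    have hs := hsep i j hij'
    have e1 := Int.floor_le (m i / h)
    have e2 := Int.lt_floor_add_one (m i / h)
    have e3 := Int.floor_le (m j / h)
    have e4 := Int.lt_floor_add_one (m j / h)
    rw [le_div_iff₀ hh] at e1 e3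
    rw [div_lt_iff₀ hh] at e2 e4
    have hxi := hxm i
    have hxj := hxm j
    have ri := hr' i
    have rj := hr' j
    rw [Metric.mem_ball, Real.dist_eq, abs_lt] at hxi hxj
    simp only [Real.dist_eq]
    rcases lt_trichotomy ⌊m i / h⌋ ⌊m j / h⌋ with hlt | heq | hlt
    · have : (⌊m i / h⌋ : ℤ) + 4 ≤ ⌊m j / h⌋ := by omega
      have h5 : ((⌊m i / h⌋ : ℤ) : ℝ) + 4 ≤ (⌊m j / h⌋ : ℤ) := by exact_mod_cast this
      have h6 := mul_le_mul_of_nonneg_right h5 hh.le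
      rw [lt_abs]
      right
      linarith
    · rw [heq] at e1 e2
      rw [lt_abs] at hs
      rcases hs with hs | hs <;> linarith
    · have : (⌊m j / h⌋ : ℤ) + 4 ≤ ⌊m i / h⌋ := by omega
      have h5 : ((⌊m j / h⌋ : ℤ) : ℝ) + 4 ≤ (⌊m i / h⌋ : ℤ) := by exact_mod_cast this
      have h6 := mul_le_mul_of_nonneg_right h5 hh.le
      rw [lt_abs]
      left
      linarith
  rw [← ENNReal.tsum_fiberwise _ g, tsum_fintype]
  refine (Finset.sum_le_sum fun c _ => hclass c).trans ?_
  simp [ZMod.card]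

/-- The sum of the `β`-th powers over the members of a packing of one dyadic scale. -/
lemma tsum_rpow_le_of_comparable_balls {pk : Set ℝ → ℝ≥0∞ → Set (Set ℝ) → Prop}
    (hpk : IsPackingPredicate pk) {T : Set ℝ} {ι : Type*} [Countable ι] {B : ι → Set ℝ} {h : ℝ}
    (hh : 0 < h) (hB : ∀ i, B i ∈ openBalls ℝ) (hlow : ∀ i, ENNReal.ofReal h < Metric.ediam (B i))
    (hupp : ∀ i, Metric.ediam (B i) ≤ ENNReal.ofReal (2 * h))
    (hdisj : ∀ i j, i ≠ j → Disjoint (B i) (B j)) (hne : ∀ i, (B i ∩ T).Nonempty) {c γ : ℝ}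
    (hc : 0 < c)
    (hA : ∀ x ∈ T, ∃ A : Set ℝ, x ∈ A ∧ Metric.ediam A ≤ ENNReal.ofReal (h / 2) ∧
      ENNReal.ofReal (c * (h / 2) ^ γ) ≤ Metric.ediam A ∧ pk {x} (ENNReal.ofReal (h / 2)) {A})
    (α β : ℝ≥0) {ε : ℝ≥0∞} (hε : ENNReal.ofReal (h / 2) ≤ ε) :
    ∑' i, Metric.ediam (B i) ^ (β : ℝ) ≤
      4 * premeasure pk α ε T * ENNReal.ofReal ((c ^ (α : ℝ))⁻¹ * 4 ^ (β : ℝ)) *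
        ENNReal.ofReal ((h / 2) ^ (β - γ * α)) := by
  choose m r hr hBr using hB
  have key := tsum_const_le_of_comparable_balls hpk (m := m) (r := r) hh
    (fun i => by
      have := hlow i
      rw [hBr, ediam_ball_real] at this
      exact (ENNReal.ofReal_lt_ofReal_iff_of_nonneg hh.le).1 this)
    (fun i => by
      have := hupp i
      rw [hBr, ediam_ball_real, ENNReal.ofReal_le_ofReal_iff (by positivity)] at this
      linarith)
    (fun i j hij => by rw [← hBr, ← hBr]; exact hdisj i j hij)
    (fun i => by rw [← hBr]; exact hne i) hA α hε
  have hh2 : 0 < h / 2 := by positivity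
  have hd : 0 < c * (h / 2) ^ γ := by positivity
  have e : ENNReal.ofReal (2 * h) ^ (β : ℝ) = ENNReal.ofReal (c * (h / 2) ^ γ) ^ (α : ℝ) *
      (ENNReal.ofReal ((c ^ (α : ℝ))⁻¹ * 4 ^ (β : ℝ)) *
        ENNReal.ofReal ((h / 2) ^ (β - γ * α))) := by
    rw [ENNReal.ofReal_rpow_of_pos (by positivity), ENNReal.ofReal_rpow_of_pos hd,
      ← ENNReal.ofReal_mul (by positivity), ← ENNReal.ofReal_mul (by positivity)]
    congr 1
    rw [Real.rpow_sub hh2, Real.mul_rpow hc.le (by positivity), ← Real.rpow_mul hh2.le,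
      show 2 * h = 4 * (h / 2) by ring, Real.mul_rpow (by norm_num) hh2.le]
    have : (h / 2) ^ (γ * α) ≠ 0 := by positivity
    have : c ^ (α : ℝ) ≠ 0 := by positivity
    field_simp
  calc ∑' i, Metric.ediam (B i) ^ (β : ℝ)
      ≤ ∑' _ : ι, ENNReal.ofReal (2 * h) ^ (β : ℝ) :=
        ENNReal.tsum_le_tsum fun i => ENNReal.rpow_le_rpow (hupp i) β.2
    _ ≤ _ := by
        simp_rw [e]
        rw [ENNReal.tsum_mul_right, mul_assoc (4 * _)]
        gcongr

end PackingDim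

/-! ### Summation over scales and the dimension criterion -/

namespace PackingDim

/-- Balls of diameter about `2 ^ (-n)` contribute at most a constant times `2 ^ (-n * (β - γ * α))`,
and only `n ≥ K` occur in a packing at scale `2 ^ (-K)`. -/
lemma quasiMeasure_openBalls_eq_zero {pk : Set ℝ → ℝ≥0∞ → Set (Set ℝ) → Prop}
    (hpk : IsPackingPredicate pk) {T : Set ℝ} {γ : ℝ} (hT : HasPackingSets pk T γ) {α β : ℝ≥0}
    (hαβ : γ * α < β) (hfin : quasiMeasure pk α T ≠ ⊤) :
    quasiMeasure (IsPackingIn (openBalls ℝ)) β T = 0 := by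
  obtain ⟨c, hc, ρ₀, hρ₀, hA⟩ := hT
  obtain ⟨ε₀, hε₀, hP⟩ : ∃ ε₀ : ℝ≥0∞, 0 < ε₀ ∧ premeasure pk α ε₀ T < ⊤ := by
    by_contra! hcon
    exact hfin (top_unique (le_iInf₂ hcon))
  set D : ℝ≥0∞ := 4 * premeasure pk α ε₀ T * ENNReal.ofReal ((c ^ (α : ℝ))⁻¹ * 4 ^ (β : ℝ))
  have hD : D ≠ ⊤ := ENNReal.mul_ne_top (ENNReal.mul_ne_top (by norm_num) hP.ne)
    ENNReal.ofReal_ne_top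
  -- Half of the spare exponent makes the series over `n` converge; the other half yields the factor
  -- `η ^ K`, which tends to `0`.
  set s : ℝ := (β - γ * α) / 2
  have hs : 0 < s := by simp only [s]; linarith
  set η : ℝ := (1 / 2) ^ s with hηdef
  have hη0 : 0 < η := by positivity
  have hη1 : η < 1 := Real.rpow_lt_one (by norm_num) (by norm_num) hs
  have hgeo : (∑' n : ℕ, ENNReal.ofReal η ^ n) ≠ ⊤ := by
    rw [ENNReal.tsum_geometric]
    refine ENNReal.inv_ne_top.2 (tsub_pos_of_lt ?_).ne'
    rwa [ENNReal.ofReal_lt_one]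
  have hpow : ∀ n : ℕ, ((1 / 2 : ℝ) ^ (n + 1) / 2) ^ (β - γ * α) ≤ η ^ n * η ^ n := by
    intro n
    have e : (β - γ * α : ℝ) = s + s := by simp only [s]; ring
    rw [e, Real.rpow_add (by positivity)]
    have h1 : ((1 / 2 : ℝ) ^ (n + 1) / 2) ^ s ≤ η ^ n := by
      rw [hηdef, Real.rpow_pow_comm (by norm_num)]
      refine Real.rpow_le_rpow (by positivity) ?_ hs.le
      rw [pow_succ]
      have : (0 : ℝ) < (1 / 2) ^ n := by positivity
      linarith
    gcongr
  have hbound : ∀ᶠ K : ℕ in atTop,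
      premeasure (IsPackingIn (openBalls ℝ)) β (ENNReal.ofReal ((1 / 2) ^ K)) T ≤
        ENNReal.ofReal η ^ K * (D * ∑' n : ℕ, ENNReal.ofReal η ^ n) := by
    have hlim : Tendsto (fun K : ℕ => (1 / 2 : ℝ) ^ K) atTop (𝓝 0) :=
      tendsto_pow_atTop_nhds_zero_of_lt_one (by norm_num) (by norm_num)
    have hlim' : Tendsto (fun K : ℕ => ENNReal.ofReal ((1 / 2 : ℝ) ^ K)) atTop (𝓝 0) := by
      simpa using ENNReal.tendsto_ofReal hlim
    filter_upwards [hlim.eventually (gt_mem_nhds hρ₀), hlim'.eventually (gt_mem_nhds hε₀)]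
      with K hK hK'
    refine iSup₂_le fun S hS => ?_
    have : Countable S := hS.countable
    have hdpos : ∀ A : S, 0 < (Metric.ediam (A : Set ℝ)).toReal ∧
        Metric.ediam (A : Set ℝ) = ENNReal.ofReal (Metric.ediam (A : Set ℝ)).toReal ∧
        (Metric.ediam (A : Set ℝ)).toReal ≤ (1 / 2) ^ K := by
      intro A
      obtain ⟨m, r, hr, hAr⟩ := hS.subset A.2
      have h1 := hS.ediam_le _ A.2
      rw [hAr, ediam_ball_real] at h1 ⊢
      rw [ENNReal.toReal_ofReal (by positivity)]
      exact ⟨by positivity, rfl, (ENNReal.ofReal_le_ofReal_iff (by positivity)).1 h1⟩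
    have hscale : ∀ A : S, ∃ n : ℕ, (1 / 2 : ℝ) ^ (n + 1) < (Metric.ediam (A : Set ℝ)).toReal ∧
        (Metric.ediam (A : Set ℝ)).toReal ≤ (1 / 2) ^ n := fun A =>
      exists_nat_pow_near_of_lt_one (hdpos A).1
        ((hdpos A).2.2.trans (pow_le_one₀ (by norm_num) (by norm_num))) (by norm_num) (by norm_num)
    choose k hk hk' using hscale
    have hKk : ∀ A, K ≤ k A := fun A => by
      have := (hk A).trans_le (hdpos A).2.2
      rw [pow_lt_pow_iff_right_of_lt_one₀ (by norm_num) (by norm_num)] at this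
      omega
    rw [← ENNReal.tsum_fiberwise _ k, ← ENNReal.tsum_mul_left, ← ENNReal.tsum_mul_left]
    refine ENNReal.tsum_le_tsum fun n => ?_
    rcases isEmpty_or_nonempty (k ⁻¹' {n}) with hemp | ⟨⟨A₀, hA₀⟩⟩
    · simp
    have hKn : K ≤ n := by
      have := hKk A₀
      rwa [show k A₀ = n from hA₀] at this
    have hρ : (1 / 2 : ℝ) ^ (n + 1) / 2 < (1 / 2) ^ K := by
      have h1 : (1 / 2 : ℝ) ^ (n + 1) ≤ (1 / 2) ^ K :=
        pow_le_pow_of_le_one (by norm_num) (by norm_num) (by omega)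
      have : (0 : ℝ) < (1 / 2) ^ (n + 1) := by positivity
      linarith
    refine (tsum_rpow_le_of_comparable_balls hpk (T := T) (h := (1 / 2) ^ (n + 1))
      (B := fun i : k ⁻¹' {n} => ((i : S) : Set ℝ)) (by positivity) (fun i => hS.subset i.1.2)
      ?_ ?_ ?_ (fun i => hS.inter_nonempty _ i.1.2) hc
      (fun x hx => hA x hx _ (by positivity) (hρ.trans hK)) α β
      ((ENNReal.ofReal_le_ofReal hρ.le).trans hK'.le)).trans ?_
    · rintro ⟨A, hA'⟩
      have h := hk A
      rw [show k A = n from hA'] at h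
      rw [(hdpos A).2.1]
      exact (ENNReal.ofReal_lt_ofReal_iff (hdpos A).1).2 h
    · rintro ⟨A, hA'⟩
      have h := hk' A
      rw [show k A = n from hA'] at h
      rw [(hdpos A).2.1]
      refine ENNReal.ofReal_le_ofReal (h.trans_eq ?_)
      rw [pow_succ]; ring
    · rintro ⟨A, hA⟩ ⟨B, hB⟩ hAB
      exact hS.disjoint A.2 B.2 fun h => hAB (Subtype.ext (Subtype.ext h))
    · calc D * ENNReal.ofReal (((1 / 2 : ℝ) ^ (n + 1) / 2) ^ (β - γ * α))
          ≤ D * (ENNReal.ofReal η ^ K * ENNReal.ofReal η ^ n) := by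
            rw [← ENNReal.ofReal_pow hη0.le, ← ENNReal.ofReal_pow hη0.le,
              ← ENNReal.ofReal_mul (by positivity)]
            gcongr
            refine (hpow n).trans (mul_le_mul_of_nonneg_right ?_ (by positivity))
            exact pow_le_pow_of_le_one hη0.le hη1.le hKn
        _ = _ := by ring
  refine le_antisymm ?_ zero_le
  have hlim : Tendsto (fun K : ℕ => ENNReal.ofReal η ^ K * (D * ∑' n : ℕ, ENNReal.ofReal η ^ n))
      atTop (𝓝 0) := by
    have h1 : Tendsto (fun K : ℕ => ENNReal.ofReal η ^ K) atTop (𝓝 0) :=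
      ENNReal.tendsto_pow_atTop_nhds_zero_of_lt_one (by rwa [ENNReal.ofReal_lt_one])
    simpa using ENNReal.Tendsto.mul_const h1 (Or.inr (ENNReal.mul_ne_top hD hgeo))
  refine ge_of_tendsto hlim (hbound.mono fun K hK => ?_)
  exact (iInf₂_le _ (ENNReal.ofReal_pos.2 (by positivity))).trans hK

/-- A criterion for the uncentered packing dimension to be at most the one given by `pk`. -/
theorem dimPUnc_le_dimOf {pk : Set ℝ → ℝ≥0∞ → Set (Set ℝ) → Prop}
    (hpk : IsPackingPredicate pk) {E : Set ℝ}
    (h : ∀ γ : ℝ, 1 < γ → ∃ T : ℕ → Set ℝ, E ⊆ ⋃ m, T m ∧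
      ∀ m, (T m).Subsingleton ∨ HasPackingSets pk (T m) γ) :
    dimPUnc E ≤ dimOf pk E := by
  refine le_iInf₂ fun α hα => le_of_forall_gt fun b hb => ?_
  obtain ⟨β, hαβ, hβb⟩ := ENNReal.lt_iff_exists_nnreal_btwn.1 hb
  have hαβ : α < β := by exact_mod_cast hαβ
  refine lt_of_le_of_lt (iInf₂_le β ?_) hβb
  obtain ⟨γ, hγ, hγβ⟩ : ∃ γ : ℝ, 1 < γ ∧ γ * α < β := by
    have h1 : ∀ᶠ γ : ℝ in 𝓝[>] 1, γ * α < β := by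
      have : Tendsto (fun γ : ℝ => γ * α) (𝓝[>] 1) (𝓝 (1 * α)) :=
        ((continuous_id.mul continuous_const).tendsto 1).mono_left nhdsWithin_le_nhds
      exact this.eventually (gt_mem_nhds (by rw [one_mul]; exact_mod_cast hαβ))
    obtain ⟨γ, h2, h3⟩ := (h1.and self_mem_nhdsWithin).exists
    exact ⟨γ, h3, h2⟩
  obtain ⟨T, hET, hT⟩ := h γ hγ
  -- The bound `1` is arbitrary: only the finiteness of each quasi-measure matters. It passes to the
  -- intersections with the `T j`.
  obtain ⟨t, hEt, ht⟩ : ∃ t : ℕ → Set ℝ, E ⊆ ⋃ j, t j ∧ ∑' j, quasiMeasure pk α (t j) < 1 := by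
    have h0 : packingMeasure pk α E < 1 := by rw [hα]; exact zero_lt_one
    simpa only [packingMeasure, iInf_lt_iff, exists_prop] using h0
  refine le_antisymm (iInf₂_le_of_le
    (fun n : ℕ => t n.unpair.1 ∩ T n.unpair.2) ?_ ?_) zero_le
  · intro x hx
    obtain ⟨i, hi⟩ := Set.mem_iUnion.1 (hEt hx)
    obtain ⟨j, hj⟩ := Set.mem_iUnion.1 (hET hx)
    exact Set.mem_iUnion.2 ⟨Nat.pair i j, by simpa using ⟨hi, hj⟩⟩
  · refine (ENNReal.tsum_eq_zero.2 fun n => ?_).le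
    rcases hT n.unpair.2 with hsub | ⟨c, hc, ρ₀, hρ₀, hA⟩
    · exact quasiMeasure_of_subsingleton _ (hsub.anti Set.inter_subset_right)
        (lt_of_le_of_lt zero_le hαβ)
    · refine quasiMeasure_openBalls_eq_zero hpk ⟨c, hc, ρ₀, hρ₀, fun x hx => hA x hx.2⟩ hγβ ?_
      refine ne_top_of_le_ne_top (ENNReal.ne_top_of_tsum_ne_top (ht.trans ENNReal.one_lt_top).ne
        n.unpair.1) (quasiMeasure_mono_pk (fun ε S => hpk.mono Set.inter_subset_left le_rfl) α)

theorem dimPUnc_eq_dimP (E : Set ℝ) : dimPUnc E = dimP E := by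
  refine le_antisymm (dimPUnc_le_dimOf isPackingPredicate_isCenteredPacking fun γ hγ => ?_)
    (dimP_le_dimPUnc E)
  refine ⟨fun _ => E, fun x hx => Set.mem_iUnion.2 ⟨0, hx⟩, fun _ => Or.inr
    ⟨1, one_pos, 1, one_pos, fun x _ ρ hρ hρ1 => ⟨Metric.ball x (ρ / 2),
      Metric.mem_ball_self (by positivity), ?_, ?_, Set.countable_singleton _, ?_, ?_, ?_⟩⟩⟩
  · rw [ediam_ball_real, mul_div_cancel₀ _ two_ne_zero]
  · rw [ediam_ball_real, mul_div_cancel₀ _ two_ne_zero, one_mul]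
    exact ENNReal.ofReal_le_ofReal
      (by simpa using Real.rpow_le_rpow_of_exponent_ge hρ hρ1.le hγ.le)
  · rintro _ rfl
    exact ⟨x, rfl, ρ / 2, by positivity, rfl⟩
  · rintro _ rfl
    rw [ediam_ball_real, mul_div_cancel₀ _ two_ne_zero]
  · exact Set.pairwiseDisjoint_singleton _ _

end PackingDim

/-! ### Geometry of cylinders and expansions -/

namespace QTilde

variable (Q : QTilde)

/-- The right end of the cylinder of rank `n` given by the first `n` digits of `a`. -/
def right (a : Q.Digits) (n : ℕ) : ℝ := Q.left a n + Q.len a n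

lemma cyl_eq (a : Q.Digits) (n : ℕ) : Q.cyl a n = Set.Icc (Q.left a n) (Q.right a n) := rfl

lemma len_pos (a : Q.Digits) (n : ℕ) : 0 < Q.len a n :=
  Finset.prod_pos fun k _ => Q.q_pos k (a k)

lemma len_succ (a : Q.Digits) (n : ℕ) : Q.len a (n + 1) = Q.len a n * Q.q n (a n) :=
  Finset.prod_range_succ _ _

lemma left_succ (a : Q.Digits) (n : ℕ) : Q.left a (n + 1) = Q.left a n + Q.term a n :=
  Finset.sum_range_succ _ _

lemma tendsto_len (a : Q.Digits) : Tendsto (Q.len a) atTop (𝓝 0) := by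
  refine squeeze_zero (fun n => (Q.len_pos a n).le) (fun n => ?_) Q.prod_max
  exact Finset.prod_le_prod (fun k _ => (Q.q_pos k _).le) fun k _ =>
    le_ciSup (Set.finite_range _).bddAbove (a k)

lemma term_nonneg (a : Q.Digits) (k : ℕ) : 0 ≤ Q.term a k :=
  mul_nonneg (Finset.sum_nonneg fun i _ => (Q.q_pos k i).le) (Q.len_pos a k).le

lemma left_lt_right (a : Q.Digits) (n : ℕ) : Q.left a n < Q.right a n :=
  lt_add_of_pos_right _ (Q.len_pos a n)

lemma left_mono (a : Q.Digits) : Monotone (Q.left a) :=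
  monotone_nat_of_le_succ fun n => by
    rw [left_succ]; exact le_add_of_nonneg_right (Q.term_nonneg a n)

lemma right_succ (a : Q.Digits) (n : ℕ) :
    Q.right a (n + 1) = Q.left a n + (∑ i ∈ Finset.Iic (a n), Q.q n i) * Q.len a n := by
  have h : ∑ i ∈ Finset.Iic (a n), Q.q n i = ∑ i ∈ Finset.Iio (a n), Q.q n i + Q.q n (a n) := by
    rw [← Finset.Iio_insert, Finset.sum_insert (by simp), add_comm]
  rw [right, left_succ, len_succ, h, term]
  ring

lemma right_anti (a : Q.Digits) : Antitone (Q.right a) :=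
  antitone_nat_of_succ_le fun n => by
    rw [right_succ, right]
    have h : ∑ i ∈ Finset.Iic (a n), Q.q n i ≤ 1 := by
      rw [← Q.sum_q n]
      exact Finset.sum_le_sum_of_subset_of_nonneg (Finset.subset_univ _)
        fun i _ _ => (Q.q_pos n i).le
    nlinarith [Q.len_pos a n]

lemma left_le_right (a : Q.Digits) (m n : ℕ) : Q.left a m ≤ Q.right a n :=
  (Q.left_mono a (le_max_left m n)).trans
    ((Q.left_lt_right a _).le.trans (Q.right_anti a (le_max_right m n)))

lemma cyl_zero (a : Q.Digits) : Q.cyl a 0 = Set.Icc 0 1 := by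
  simp [cyl, left, len]

lemma hasSum_term (a : Q.Digits) : HasSum (Q.term a) (Q.value a) := by
  refine (summable_of_sum_range_le (c := Q.right a 0) (Q.term_nonneg a) fun n => ?_).hasSum
  exact Q.left_le_right a n 0

lemma tendsto_left (a : Q.Digits) : Tendsto (Q.left a) atTop (𝓝 (Q.value a)) :=
  (Q.hasSum_term a).tendsto_sum_nat

lemma value_mem_cyl (a : Q.Digits) (n : ℕ) : Q.value a ∈ Q.cyl a n :=
  ⟨(Q.left_mono a).ge_of_tendsto (Q.tendsto_left a) n,
    le_of_tendsto' (Q.tendsto_left a) fun m => Q.left_le_right a m n⟩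

lemma value_mem_Icc (a : Q.Digits) : Q.value a ∈ Set.Icc (0 : ℝ) 1 :=
  Q.cyl_zero a ▸ Q.value_mem_cyl a 0

lemma cyl_subset_Icc (a : Q.Digits) (n : ℕ) : Q.cyl a n ⊆ Set.Icc (0 : ℝ) 1 := by
  rw [← Q.cyl_zero a]
  exact Set.Icc_subset_Icc (Q.left_mono a n.zero_le) (Q.right_anti a n.zero_le)

lemma len_left_congr {a b : Q.Digits} {n : ℕ} (h : ∀ k < n, a k = b k) :
    Q.len a n = Q.len b n ∧ Q.left a n = Q.left b n := by
  induction n with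
  | zero => simp [len, left]
  | succ n ih =>
    obtain ⟨h1, h2⟩ := ih fun k hk => h k (hk.trans n.lt_succ_self)
    rw [len_succ, len_succ, left_succ, left_succ, term, term, h1, h2, h n n.lt_succ_self]
    exact ⟨rfl, rfl⟩

lemma right_le_left {a b : Q.Digits} {k : ℕ} (h : ∀ j < k, a j = b j) (hk : a k < b k) :
    Q.right a (k + 1) ≤ Q.left b (k + 1) := by
  obtain ⟨h1, h2⟩ := Q.len_left_congr h
  rw [right_succ, left_succ, term, h1, h2]
  have : ∑ i ∈ Finset.Iic (a k), Q.q k i ≤ ∑ i ∈ Finset.Iio (b k), Q.q k i :=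
    Finset.sum_le_sum_of_subset_of_nonneg
      (fun i hi => Finset.mem_Iio.2 ((Finset.mem_Iic.1 hi).trans_lt hk))
      fun i _ _ => (Q.q_pos k i).le
  have := mul_le_mul_of_nonneg_right this (Q.len_pos b k).le
  linarith

lemma exists_first_diff {a b : Q.Digits} (hab : a ≠ b) :
    ∃ k, (∀ j < k, a j = b j) ∧ (a k < b k ∨ b k < a k) := by
  classical
  have h : ∃ k, a k ≠ b k := Function.ne_iff.1 hab
  exact ⟨Nat.find h, fun j hj => not_not.1 (Nat.find_min h hj), lt_or_gt_of_ne (Nat.find_spec h)⟩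

/-- A number has at most two expansions. -/
lemma finite_setOf_value_eq (x : ℝ) : {a | Q.value a = x}.Finite := by
  -- Expansions are sorted by whether `x` is ever the right end of its cylinder. Within either
  -- class, the first differing digit would put `x` on the wrong side of the end that separates the
  -- two cylinders.
  have hR : {a | Q.value a = x ∧ ∀ n, x < Q.right a n}.Subsingleton := by
    have key : ∀ a b : Q.Digits, Q.value b = x → (∀ n, x < Q.right a n) → ∀ k,
        (∀ j < k, a j = b j) → ¬ a k < b k := fun a b hb ha k hk hlt =>
      absurd (ha (k + 1)) (not_lt.2 ((Q.right_le_left hk hlt).trans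
        (hb ▸ (Q.value_mem_cyl b (k + 1)).1)))
    rintro a ⟨ha, ha'⟩ b ⟨hb, hb'⟩
    by_contra hab
    obtain ⟨k, hk, hlt | hlt⟩ := Q.exists_first_diff hab
    · exact key a b hb ha' k hk hlt
    · exact key b a ha hb' k (fun j hj => (hk j hj).symm) hlt
  have hL : {a | Q.value a = x ∧ ∃ n, Q.right a n ≤ x}.Subsingleton := by
    have key : ∀ a b : Q.Digits, Q.value a = x → Q.value b = x → (∃ n, Q.right b n ≤ x) → ∀ k,
        (∀ j < k, a j = b j) → ¬ a k < b k := by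
      rintro a b ha hb ⟨n, hn⟩ k hk hlt
      have h1 : x ≤ Q.left b (k + 1) :=
        (ha ▸ (Q.value_mem_cyl a (k + 1)).2).trans (Q.right_le_left hk hlt)
      have h2 := Q.left_mono b (le_max_left (k + 1) n)
      have h3 := Q.right_anti b (le_max_right (k + 1) n)
      linarith [Q.left_lt_right b (max (k + 1) n)]
    rintro a ⟨ha, ha'⟩ b ⟨hb, hb'⟩
    by_contra hab
    obtain ⟨k, hk, hlt | hlt⟩ := Q.exists_first_diff hab
    · exact key a b ha hb hb' k hk hlt
    · exact key b a hb ha ha' k (fun j hj => (hk j hj).symm) hlt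
  refine (hR.finite.union hL.finite).subset fun a ha => ?_
  rcases em (∀ n, x < Q.right a n) with h | h
  · exact Or.inl ⟨ha, h⟩
  · push Not at h
    exact Or.inr ⟨ha, h⟩

/-- The digits `r` followed by those of `a`. -/
def prepend (a : Q.Digits) (n : ℕ) (r : (k : Fin n) → Fin (Q.N k)) : Q.Digits :=
  fun k => if h : k < n then r ⟨k, h⟩ else a k

lemma prepend_restrict (a b : Q.Digits) {n k : ℕ} (hk : k < n) :
    Q.prepend a n (fun j => b j) k = b k := by
  simp [prepend, hk]

lemma countable_setOf_eventually_eq (a : Q.Digits) :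
    {b : Q.Digits | ∀ᶠ k in atTop, b k = a k}.Countable := by
  refine (Set.countable_iUnion fun n => Set.countable_range (Q.prepend a n)).mono fun b hb => ?_
  obtain ⟨n, hn⟩ := eventually_atTop.1 hb
  refine Set.mem_iUnion.2 ⟨n, fun j => b j, funext fun k => ?_⟩
  rcases lt_or_ge k n with hk | hk
  · exact Q.prepend_restrict a b hk
  · simp [prepend, hk.not_gt, hn k hk]

/-- The ends of the cylinders. -/
def ends : Set ℝ := {x | ∃ (a : Q.Digits) (n : ℕ), x = Q.left a n ∨ x = Q.right a n}

lemma countable_ends : Q.ends.Countable := by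
  rcases isEmpty_or_nonempty Q.Digits with h | ⟨⟨a⟩⟩
  · refine Set.countable_empty.mono ?_
    rintro x ⟨b, -⟩
    exact h.elim b
  refine (Set.countable_iUnion fun n =>
    (Set.countable_range fun r => Q.left (Q.prepend a n r) n).union
      (Set.countable_range fun r => Q.right (Q.prepend a n r) n)).mono ?_
  rintro x ⟨b, n, hx⟩
  obtain ⟨h1, h2⟩ := Q.len_left_congr fun k (hk : k < n) => Q.prepend_restrict a b hk
  refine Set.mem_iUnion.2 ⟨n, hx.imp (fun h => ⟨fun j => b j, ?_⟩)
    fun h => ⟨fun j => b j, ?_⟩⟩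
  · exact h ▸ h2
  · simp only [h, right, h1, h2]

/-! ### Independent digits: an atom forces a discrete distribution -/

section Random

variable {Ω : Type*} [MeasurableSpace Ω] {ξ : (k : ℕ) → Ω → Fin (Q.N k)}

lemma measurable_value (hξ : ∀ k, Measurable (ξ k)) :
    Measurable fun ω => Q.value fun k => ξ k ω := by
  have hlen : ∀ n, Measurable fun ω => Q.len (fun k => ξ k ω) n := fun n =>
    Finset.measurable_prod _ fun k _ => (measurable_of_countable (Q.q k)).comp (hξ k)
  refine measurable_of_tendsto_metrizable (f := fun n ω => Q.left (fun k => ξ k ω) n)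
    (fun n => Finset.measurable_sum _ fun k _ => ?_)
    (tendsto_pi_nhds.2 fun ω => Q.tendsto_left fun k => ξ k ω)
  exact ((measurable_of_countable fun i => ∑ j ∈ Finset.Iio i, Q.q k j).comp (hξ k)).mul (hlen k)

variable {P : Measure Ω} [IsProbabilityMeasure P]

/-- If one value is taken with positive probability, then the distribution is discrete. -/
lemma exists_countable_of_atom (hξ : ∀ k, Measurable (ξ k)) (hind : iIndepFun ξ P) {x : ℝ}
    (hx : P.map (fun ω => Q.value (fun k => ξ k ω)) {x} ≠ 0) :
    ∃ C : Set ℝ, C.Countable ∧ P.map (fun ω => Q.value (fun k => ξ k ω)) Cᶜ = 0 := by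
  have hv := Q.measurable_value hξ
  -- An atom has only finitely many expansions, so one of them carries positive probability.
  obtain ⟨a, ha⟩ : ∃ a : Q.Digits, P {ω | ∀ k, ξ k ω = a k} ≠ 0 := by
    by_contra! hcon
    refine hx ?_
    rw [Measure.map_apply hv (measurableSet_singleton x)]
    refine measure_mono_null (t := ⋃ a ∈ {a | Q.value a = x}, {ω | ∀ k, ξ k ω = a k}) ?_
      ((measure_biUnion_null_iff (Q.finite_setOf_value_eq x).countable).2 fun a _ => hcon a)
    intro ω hω
    exact Set.mem_biUnion (show (fun k => ξ k ω) ∈ {a | Q.value a = x} from hω) fun k => rfl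
  have hmeas : ∀ k, MeasurableSet {ω | ξ k ω ≠ a k} := fun k =>
    hξ k (measurableSet_singleton (a k)).compl
  -- If the sum diverged, the second Borel–Cantelli lemma would make the digits differ from `a`
  -- infinitely often almost surely, so that `a` itself would have probability `0`.
  have hsum : ∑' k, P {ω | ξ k ω ≠ a k} ≠ ⊤ := by
    intro htop
    have hset : iIndepSet (fun k => {ω | ξ k ω ≠ a k}) P := by
      rw [iIndepSet_iff_meas_biInter hmeas]
      intro s
      exact hind.meas_biInter (s := fun k => {ω | ξ k ω ≠ a k})
        fun k _ => ⟨{a k}ᶜ, (measurableSet_singleton _).compl, rfl⟩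
    have h1 := measure_limsup_eq_one hmeas hset htop
    have h2 : MeasurableSet (limsup (fun k => {ω | ξ k ω ≠ a k}) atTop) :=
      MeasurableSet.measurableSet_limsup hmeas
    rw [← prob_compl_eq_zero_iff h2] at h1
    refine ha (measure_mono_null (fun ω hω => ?_) h1)
    rw [Set.mem_compl_iff, mem_limsup_iff_frequently_mem]
    simp only [Set.mem_ofPred_eq] at hω
    simp [hω]
  -- By the first Borel–Cantelli lemma the digits almost surely agree with `a` from some place on,
  -- which leaves countably many values.
  have hlim := measure_limsup_atTop_eq_zero hsum
  refine ⟨Q.value '' {b | ∀ᶠ k in atTop, b k = a k},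
    (Q.countable_setOf_eventually_eq a).image _, ?_⟩
  rw [Measure.map_apply hv ((Q.countable_setOf_eventually_eq a).image _).measurableSet.compl]
  refine measure_mono_null (fun ω hω => ?_) hlim
  rw [mem_limsup_iff_frequently_mem]
  intro hcon
  refine hω ⟨_, ?_, rfl⟩
  simpa using hcon

end Random

end QTilde

/-- The range of the distribution function of a discrete distribution is a null set. -/
lemma volume_range_cdf_eq_zero (μ : Measure ℝ) [IsProbabilityMeasure μ] {C : Set ℝ}
    (hC : C.Countable) (hμC : μ Cᶜ = 0) : volume (Set.range (cdf μ)) = 0 := by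
  have hmono := monotone_cdf μ
  -- The range misses these jump gaps, whose lengths are the masses of the atoms and hence add up to
  -- `1`.
  let G : ℝ → Set ℝ := fun x => Set.Ioo (Function.leftLim (cdf μ) x) (cdf μ x)
  have hGd : C.PairwiseDisjoint G := by
    have key : ∀ x y, x < y → Disjoint (G x) (G y) := fun x y hxy =>
      Set.disjoint_left.2 fun z hz hz' =>
        lt_irrefl z (hz.2.trans_le ((hmono.le_leftLim hxy).trans hz'.1.le))
    intro x _ y _ hxy
    rcases lt_or_gt_of_ne hxy with h | h
    · exact key x y h
    · exact (key y x h).symm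
  have hGm : MeasurableSet (⋃ x ∈ C, G x) := .biUnion hC fun x _ => measurableSet_Ioo
  have hvol : volume (⋃ x ∈ C, G x) = 1 := by
    rw [measure_biUnion hC hGd fun x _ => measurableSet_Ioo]
    have h1 : ∀ x, volume (G x) = μ {x} := fun x => by
      conv_rhs => rw [← measure_cdf μ, StieltjesFunction.measure_singleton]
      exact Real.volume_Ioo
    simp_rw [h1]
    rw [← measure_biUnion hC (fun x _ y _ hxy => Set.disjoint_singleton.2 hxy)
      fun x _ => measurableSet_singleton x, Set.biUnion_of_singleton]
    exact (prob_compl_eq_zero_iff hC.measurableSet).1 hμC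
  have hsub : Set.range (cdf μ) ⊆ Set.Icc 0 1 \ ⋃ x ∈ C, G x := by
    rintro _ ⟨z, rfl⟩
    refine ⟨⟨cdf_nonneg μ z, cdf_le_one μ z⟩, fun hz => ?_⟩
    obtain ⟨x, -, hx⟩ := Set.mem_iUnion₂.1 hz
    rcases lt_or_ge z x with h | h
    · exact absurd hx.1 (not_lt.2 (hmono.le_leftLim h))
    · exact absurd hx.2 (not_lt.2 (hmono h))
  have hG01 : (⋃ x ∈ C, G x) ⊆ Set.Icc 0 1 := by
    refine Set.iUnion₂_subset fun x _ z hz => ⟨?_, hz.2.le.trans (cdf_le_one μ x)⟩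
    exact (cdf_nonneg μ (x - 1)).trans ((hmono.le_leftLim (sub_one_lt x)).trans hz.1.le)
  refine measure_mono_null hsub ?_
  rw [measure_sdiff hG01 hGm.nullMeasurableSet (by rw [hvol]; exact ENNReal.one_ne_top), hvol]
  simp

lemma continuous_cdf (μ : Measure ℝ) [IsProbabilityMeasure μ] (h : ∀ x, μ {x} = 0) :
    Continuous (cdf μ) := by
  refine continuous_iff_continuousAt.2 fun x => ?_
  rw [(monotone_cdf μ).continuousAt_iff_leftLim_eq_rightLim, StieltjesFunction.rightLim_eq]
  refine le_antisymm ((monotone_cdf μ).leftLim_le le_rfl) ?_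
  have := h x
  rw [← measure_cdf μ, StieltjesFunction.measure_singleton, ENNReal.ofReal_eq_zero] at this
  linarith

/-! ### Images of cylinders under the distribution function -/

namespace QTilde

open PackingDim

variable (Q : QTilde) {F : ℝ → ℝ}

lemma left_mem_Icc (a : Q.Digits) (n : ℕ) : Q.left a n ∈ Set.Icc (0 : ℝ) 1 :=
  Q.cyl_subset_Icc a n (Set.left_mem_Icc.2 (Q.left_lt_right a n).le)

lemma right_mem_Icc (a : Q.Digits) (n : ℕ) : Q.right a n ∈ Set.Icc (0 : ℝ) 1 :=
  Q.cyl_subset_Icc a n (Set.right_mem_Icc.2 (Q.left_lt_right a n).le)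

/-- A monotone function that is not constant on small cylinders is strictly monotone. -/
lemma strictMonoOn_of_volume_image_ne_zero (hF : Monotone F)
    (h : ∀ x ∈ Set.Icc (0 : ℝ) 1, ∃ a : Q.Digits, (∀ n, x ∈ Q.cyl a n) ∧
      ∀ᶠ n in atTop, volume.real (F '' Q.cyl a n) ≠ 0) :
    StrictMonoOn F (Set.Icc 0 1) := by
  intro x hx y hy hxy
  refine (hF hxy.le).lt_of_ne fun heq => ?_
  obtain ⟨z, hxz, hzy⟩ := exists_between hxy
  obtain ⟨a, ha, ha'⟩ := h z ⟨hx.1.trans hxz.le, hzy.le.trans hy.2⟩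
  -- A cylinder around `z` this short lies in `(x, y)`, where `F` is constant.
  have hlen : ∀ᶠ n in atTop, Q.len a n < min (z - x) (y - z) :=
    (Q.tendsto_len a).eventually (gt_mem_nhds (lt_min (sub_pos.2 hxz) (sub_pos.2 hzy)))
  obtain ⟨n, hn, hn'⟩ := (ha'.and hlen).exists
  refine hn ?_
  have hsub : F '' Q.cyl a n ⊆ {F x} := by
    rintro _ ⟨w, hw, rfl⟩
    obtain ⟨h1, h2⟩ := lt_min_iff.1 hn'
    obtain ⟨h3, h4⟩ := ha n
    obtain ⟨h5, h6⟩ := hw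
    exact le_antisymm (heq ▸ hF (by linarith)) (hF (by linarith))
  rw [measureReal_def, measure_mono_null hsub (by simp), ENNReal.toReal_zero]

section Homeo

variable (hcont : Continuous F) (hmono : StrictMonoOn F (Set.Icc 0 1))
include hcont hmono

lemma image_cyl (a : Q.Digits) (n : ℕ) :
    F '' Q.cyl a n = Set.Icc (F (Q.left a n)) (F (Q.right a n)) := by
  refine Set.Subset.antisymm ?_
    (intermediate_value_Icc (Q.left_lt_right a n).le hcont.continuousOn)
  rintro _ ⟨x, hx, rfl⟩
  have hx' := Q.cyl_subset_Icc a n hx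
  exact ⟨hmono.monotoneOn (Q.left_mem_Icc a n) hx' hx.1,
    hmono.monotoneOn hx' (Q.right_mem_Icc a n) hx.2⟩

lemma image_interior_cyl (a : Q.Digits) (n : ℕ) :
    F '' interior (Q.cyl a n) = Set.Ioo (F (Q.left a n)) (F (Q.right a n)) := by
  rw [cyl_eq, interior_Icc]
  refine Set.Subset.antisymm ?_
    (intermediate_value_Ioo (Q.left_lt_right a n).le hcont.continuousOn)
  rintro _ ⟨x, hx, rfl⟩
  have hx' := Q.cyl_subset_Icc a n (Set.Ioo_subset_Icc_self hx)
  exact ⟨hmono (Q.left_mem_Icc a n) hx' hx.1, hmono hx' (Q.right_mem_Icc a n) hx.2⟩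

lemma image_cylIntervals_subset_openBalls :
    (fun A => F '' A) '' Q.cylIntervals ⊆ openBalls ℝ := by
  rintro _ ⟨_, ⟨a, n, rfl⟩, rfl⟩
  have hlt := hmono (Q.left_mem_Icc a n) (Q.right_mem_Icc a n) (Q.left_lt_right a n)
  refine ⟨_, _, ?_, (Q.image_interior_cyl hcont hmono a n).trans (Real.Ioo_eq_ball _ _)⟩
  linarith

/-- At the points where `F` changes the lengths of all cylinders of rank at least `m` at most by
the exponent `s`, images of cylinders are available at all small scales. -/
lemma hasPackingSets_image {c : ℝ} (hc : 0 < c) (hq : ∀ k i, c ≤ Q.q k i) {s : ℝ} (hs : 0 < s)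
    (m : ℕ) :
    HasPackingSets (IsPackingIn ((fun A => F '' A) '' Q.cylIntervals))
      (F '' {x | x ∉ Q.ends ∧ ∃ a : Q.Digits, (∀ n, x ∈ Q.cyl a n) ∧ ∀ n ≥ m,
        Q.len a n ^ s ≤ F (Q.right a n) - F (Q.left a n) ∧
        (F (Q.right a n) - F (Q.left a n)) ^ s ≤ Q.len a n}) (s * s) := by
  classical
  refine ⟨c ^ s, by positivity, (c ^ m) ^ s, by positivity, ?_⟩
  rintro _ ⟨x, ⟨hx, a, hxa, ha⟩, rfl⟩ ρ hρ hρ'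
  set L : ℕ → ℝ := fun n => F (Q.right a n) - F (Q.left a n)
  have hL : ∀ n, 0 < L n := fun n =>
    sub_pos.2 (hmono (Q.left_mem_Icc a n) (Q.right_mem_Icc a n) (Q.left_lt_right a n))
  -- The required set is the image of the first cylinder of rank at least `m` whose image has length
  -- at most `ρ`.
  have hex : ∃ n, m ≤ n ∧ L n ≤ ρ := by
    obtain ⟨n, hn, hmn⟩ := (((Q.tendsto_len a).eventually
      (gt_mem_nhds (Real.rpow_pos_of_pos hρ s))).and (eventually_ge_atTop m)).exists
    exact ⟨n, hmn, ((Real.rpow_lt_rpow_iff (hL n).le hρ.le hs).1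
      ((ha n hmn).2.trans_lt hn)).le⟩
  obtain ⟨hmn, hnρ⟩ := Nat.find_spec hex
  have hmin := fun k (hk : k < Nat.find hex) => Nat.find_min hex hk
  set n := Nat.find hex
  -- The threshold `(c ^ m) ^ s` bounds `L m` from below. Hence the chosen rank exceeds `m`, and the
  -- preceding rank `k` still satisfies both length estimates.
  have hLm : ρ < L m := by
    refine hρ'.trans_le (le_trans ?_ (ha m le_rfl).1)
    refine Real.rpow_le_rpow (by positivity) ?_ hs.le
    have := Finset.prod_le_prod (s := Finset.range m) (fun k _ => hc.le) fun k _ => hq k (a k)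
    rwa [Finset.prod_const, Finset.card_range] at this
  obtain ⟨k, hk⟩ : ∃ k, n = k + 1 := by
    refine Nat.exists_eq_succ_of_ne_zero fun h0 => ?_
    have : m = n := by omega
    exact absurd hnρ (not_le.2 (this ▸ hLm))
  have hmk : m ≤ k := by
    by_contra h
    have : m = n := by omega
    exact absurd hnρ (not_le.2 (this ▸ hLm))
  have hkρ : ρ < L k := by
    have := hmin k (by omega)
    simpa [hmk] using this
  -- The exponent `s` is paid twice: passing from the image to the cylinder at rank `k`, and back to
  -- the image at rank `n`. One subdivision costs only the factor `c`.
  have hlow : c ^ s * ρ ^ (s * s) ≤ L n := by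
    calc c ^ s * ρ ^ (s * s) = c ^ s * (ρ ^ s) ^ s := by rw [← Real.rpow_mul hρ.le]
      _ ≤ c ^ s * Q.len a k ^ s := by
          gcongr
          exact (Real.rpow_le_rpow hρ.le hkρ.le hs.le).trans (ha k hmk).2
      _ = (Q.len a k * c) ^ s := by rw [mul_comm, Real.mul_rpow (Q.len_pos a k).le hc.le]
      _ ≤ Q.len a n ^ s := by
          rw [hk, len_succ]
          have := (Q.len_pos a k).le
          exact Real.rpow_le_rpow (by positivity)
            (mul_le_mul_of_nonneg_left (hq k (a k)) this) hs.le
      _ ≤ L n := (ha n hmn).1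
  have himg := Q.image_interior_cyl hcont hmono a n
  have hdiam : Metric.ediam (F '' interior (Q.cyl a n)) = ENNReal.ofReal (L n) := by
    rw [himg, Real.ediam_Ioo]
  have hxi : F x ∈ F '' interior (Q.cyl a n) := by
    refine Set.mem_image_of_mem F ?_
    rw [cyl_eq, interior_Icc]
    exact ⟨(hxa n).1.lt_of_ne fun h => hx ⟨a, n, Or.inl h.symm⟩,
      (hxa n).2.lt_of_ne fun h => hx ⟨a, n, Or.inr h⟩⟩
  have hle : Metric.ediam (F '' interior (Q.cyl a n)) ≤ ENNReal.ofReal ρ :=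
    hdiam ▸ ENNReal.ofReal_le_ofReal hnρ
  refine ⟨_, hxi, hle, hdiam ▸ ENNReal.ofReal_le_ofReal hlow, Set.countable_singleton _, ?_, ?_, ?_,
    Set.pairwiseDisjoint_singleton _ _⟩
  · exact Set.singleton_subset_iff.2 ⟨_, ⟨a, n, rfl⟩, rfl⟩
  · rintro _ rfl
    exact hle
  · rintro _ rfl
    exact ⟨F x, hxi, rfl⟩

/-- If `F` asymptotically preserves the logarithms of the lengths of cylinders, then the images of
cylinders determine the uncentered packing dimension. -/
theorem dimPIn_image_cylIntervals (h0 : F 0 = 0) (h1 : F 1 = 1) {c : ℝ} (hc : 0 < c)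
    (hq : ∀ k i, c ≤ Q.q k i)
    (hlim : ∀ x ∈ Set.Icc (0 : ℝ) 1, ∃ a : Q.Digits, (∀ n, x ∈ Q.cyl a n) ∧
      Tendsto (fun n : ℕ => Real.log (volume.real (F '' Q.cyl a n)) /
        Real.log (volume.real (Q.cyl a n))) atTop (𝓝 1)) {E : Set ℝ}
    (hE : E ⊆ Set.Icc (0 : ℝ) 1) :
    dimPIn ((fun A => F '' A) '' Q.cylIntervals) E = dimPUnc E := by
  refine le_antisymm (dimPIn_mono (Q.image_cylIntervals_subset_openBalls hcont hmono) E)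
    (dimPUnc_le_dimOf (isPackingPredicate_isPackingIn _) fun γ hγ => ?_)
  set s := Real.sqrt γ
  have hs : 1 < s := by rwa [Real.lt_sqrt zero_le_one, one_pow]
  have hs0 : 0 < s := one_pos.trans hs
  have hss : s * s = γ := Real.mul_self_sqrt (one_pos.trans hγ).le
  -- Ends may be missed by the open cylinders, so their images enter the cover as singletons.
  obtain ⟨f, hf⟩ := Set.countable_iff_exists_subset_range.1 (Q.countable_ends.image F)
  let T : ℕ → Set ℝ := fun m => F '' {x | x ∉ Q.ends ∧ ∃ a : Q.Digits, (∀ n, x ∈ Q.cyl a n) ∧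
    ∀ n ≥ m, Q.len a n ^ s ≤ F (Q.right a n) - F (Q.left a n) ∧
        (F (Q.right a n) - F (Q.left a n)) ^ s ≤ Q.len a n}
  refine ⟨fun n => Sum.elim (fun j => {f j}) T (Equiv.natSumNatEquivNat.symm n), ?_, fun n => ?_⟩
  · intro y hy
    rw [← h0, ← h1] at hE
    obtain ⟨x, hx, rfl⟩ := intermediate_value_Icc zero_le_one hcont.continuousOn (hE hy)
    by_cases hxe : x ∈ Q.ends
    · obtain ⟨j, hj⟩ := hf (Set.mem_image_of_mem F hxe)
      exact Set.mem_iUnion.2 ⟨Equiv.natSumNatEquivNat (Sum.inl j), by simp [hj]⟩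
    obtain ⟨a, hxa, ha⟩ := hlim x hx
    have hev : ∀ᶠ n in atTop, Q.len a n ^ s ≤ F (Q.right a n) - F (Q.left a n) ∧
        (F (Q.right a n) - F (Q.left a n)) ^ s ≤ Q.len a n := by
      filter_upwards [ha.eventually (gt_mem_nhds hs),
        ha.eventually (lt_mem_nhds (inv_lt_one_of_one_lt₀ hs)),
        (Q.tendsto_len a).eventually (gt_mem_nhds one_pos)] with n hn1 hn2 hn3
      have hlt := hmono (Q.left_mem_Icc a n) (Q.right_mem_Icc a n) (Q.left_lt_right a n)
      have hl := Q.len_pos a n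
      rw [Q.image_cyl hcont hmono, Real.volume_real_Icc_of_le hlt.le, cyl_eq,
        Real.volume_real_Icc_of_le (Q.left_lt_right a n).le, right, add_sub_cancel_left] at hn1 hn2
      rw [← right] at hn1 hn2
      have hL := sub_pos.2 hlt
      -- Lengths below `1` have negative logarithms, so the bounds `s⁻¹` and `s` on the ratio turn
      -- into reversed inequalities.
      have hneg := Real.log_neg hl hn3
      rw [div_lt_iff_of_neg hneg] at hn1
      rw [lt_div_iff_of_neg hneg, inv_mul_eq_div, lt_div_iff₀ hs0] at hn2
      constructor
      · rw [← Real.log_le_log_iff (by positivity) hL, Real.log_rpow hl]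
        exact hn1.le
      · rw [← Real.log_le_log_iff (by positivity) hl, Real.log_rpow hL]
        linarith
    obtain ⟨m, hm⟩ := eventually_atTop.1 hev
    exact Set.mem_iUnion.2 ⟨Equiv.natSumNatEquivNat (Sum.inr m), by
      rw [Equiv.symm_apply_apply]
      exact ⟨x, ⟨hxe, a, hxa, hm⟩, rfl⟩⟩
  · beta_reduce
    rcases Equiv.natSumNatEquivNat.symm n with j | m
    · exact Or.inl Set.subsingleton_singleton
    · exact Or.inr (hss ▸ Q.hasPackingSets_image hcont hmono hc hq hs0 m)

end Homeo

end QTilde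

end
theorem lemma2 (Q : QTilde) (hq : ∃ c : ℝ, 0 < c ∧ ∀ k i, c ≤ Q.q k i)
    {Ω : Type*} [MeasurableSpace Ω] (P : Measure Ω) [IsProbabilityMeasure P]
    (ξ : (k : ℕ) → Ω → Fin (Q.N k)) (hξ : ∀ k, Measurable (ξ k)) (hind : iIndepFun ξ P)
    (F : ℝ → ℝ) (hF : ∀ x, F x = cdf (P.map (fun ω => Q.value (fun k => ξ k ω))) x)
    (hlim : ∀ x ∈ Set.Icc (0 : ℝ) 1, ∃ a : Q.Digits, (∀ n, x ∈ Q.cyl a n) ∧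
      Tendsto (fun n : ℕ => Real.log (volume.real (F '' Q.cyl a n)) /
        Real.log (volume.real (Q.cyl a n))) atTop (𝓝 1)) :
    PackingDim.IsFaithfulOn ((fun A => F '' A) '' Q.cylIntervals) (Set.Icc (0 : ℝ) 1) ∧
      ∀ E ⊆ Set.Icc (0 : ℝ) 1,
        PackingDim.dimPIn ((fun A => F '' A) '' Q.cylIntervals) E = PackingDim.dimP E := by
  obtain ⟨c, hc, hq⟩ := hq
  have hv := Q.measurable_value hξ
  set μ := P.map (fun ω => Q.value (fun k => ξ k ω)) with hμ
  have : IsProbabilityMeasure μ := Measure.isProbabilityMeasure_map hv.aemeasurable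
  obtain rfl : F = cdf μ := funext hF
  -- Since `Real.log 0 = 0`, a null image would make the ratio `0`, which is excluded near the limit
  -- `1`.
  have hne : ∀ a : Q.Digits, Tendsto (fun n : ℕ => Real.log (volume.real (cdf μ '' Q.cyl a n)) /
      Real.log (volume.real (Q.cyl a n))) atTop (𝓝 1) →
      ∀ᶠ n in atTop, volume.real (cdf μ '' Q.cyl a n) ≠ 0 := fun a ha => by
    filter_upwards [ha.eventually (lt_mem_nhds one_pos)] with n hn h
    simp [h] at hn
  have hatom : ∀ x, μ {x} = 0 := by
    intro x
    by_contra hx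
    obtain ⟨C, hC, hμC⟩ := Q.exists_countable_of_atom hξ hind hx
    -- Any one point will do: a null range makes the image of every cylinder null.
    obtain ⟨a, -, ha⟩ := hlim 0 ⟨le_rfl, zero_le_one⟩
    obtain ⟨n, hn⟩ := (hne a ha).exists
    refine hn ?_
    rw [measureReal_def, measure_mono_null (Set.image_subset_range _ _)
      (volume_range_cdf_eq_zero μ hC hμC), ENNReal.toReal_zero]
  have hmono : StrictMonoOn (cdf μ) (Set.Icc 0 1) :=
    Q.strictMonoOn_of_volume_image_ne_zero (monotone_cdf μ) fun x hx =>
      let ⟨a, ha, ha'⟩ := hlim x hx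
      ⟨a, ha, hne a ha'⟩
  have hsupp : μ (Set.Icc 0 1)ᶜ = 0 := by
    rw [hμ, Measure.map_apply hv measurableSet_Icc.compl]
    convert measure_empty (μ := P)
    exact Set.eq_empty_of_forall_notMem fun ω hω => hω (Q.value_mem_Icc _)
  have h0 : cdf μ 0 = 0 := by
    rw [cdf_eq_real, measureReal_def, measure_mono_null (t := {0} ∪ (Set.Icc 0 1)ᶜ) ?_
      (measure_union_null (hatom 0) hsupp), ENNReal.toReal_zero]
    intro x hx
    rcases eq_or_lt_of_le (show x ≤ 0 from hx) with h | h
    · exact Or.inl h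
    · exact Or.inr fun h' => absurd h'.1 (not_le.2 h)
  have h1 : cdf μ 1 = 1 := by
    have : μ (Set.Iic 1)ᶜ = 0 :=
      measure_mono_null (Set.compl_subset_compl.2 Set.Icc_subset_Iic_self) hsupp
    rw [cdf_eq_real, measureReal_def, (prob_compl_eq_zero_iff measurableSet_Iic).1 this,
      ENNReal.toReal_one]
  have key := fun E (hE : E ⊆ Set.Icc (0 : ℝ) 1) =>
    Q.dimPIn_image_cylIntervals (continuous_cdf μ hatom) hmono h0 h1 hc hq hlim hE
  exact ⟨key, fun E hE => (key E hE).trans (PackingDim.dimPUnc_eq_dimP E)⟩
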